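/- Let $N\ge 1$, let $\Omega\subset\mathbb R^N$ be a bounded domain (nonempty, open, connected) with $C^2$ boundary, and let $p>1$. Let $D$ be the set of all $v\in C(\overline\Omega)$ such that $v\in W^{2,q}(\Omega)$ for some $q\in(N,\infty)$, $\Delta v\in C(\overline\Omega)$ and $\frac{\partial v}{\partial n}=0$ on $\partial\Omega$, endowed with the graph norm $\|v\|_\infty+\|\Delta v\|_\infty$. Let $0<T\le\infty$, let $u_0\in C(\overline\Omega)$ satisfy $\int_\Omega u_0=0$, and let $$u\in C\big([0,T);C(\overline\Omega)\big)\cap C^1\big((0,T);C(\overline\Omega)\big)\cap C\big((0,T);D\big)$$ be a solution of $$u_t-\Delta u=|u|^p-\frac1{|\Omega|}\int_\Omega|u|^p\ \text{ in }(0,T)\times\Omega,\qquad \frac{\partial u}{\partial n}=0\ \text{ on }(0,T)\times\partial\Omega,\qquad u(0)=u_0 .$$ Then for every $t\in(0,T)$ the functions $|\nabla u(t)|^2$ and $u(t)|u(t)|^p$ are integrable on $\Omega$, and the energy $$E(u(t))=\int_\Omega\Big(\frac12|\nabla u(t)|^2-\frac1{p+1}\,u(t)\,|u(t)|^p\Big)\,dx$$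 is a nonincreasing function of $t$ on $(0,T)$. -/

import Mathlib

open MeasureTheory Set Filter Topology
open scoped ContDiff BoundedContinuousFunction

namespace NonlocalHeat

noncomputable section

/-- The Euclidean space `ℝᴺ`. -/
abbrev Space (N : ℕ) : Type := EuclideanSpace ℝ (Fin N)

/-! ### Bounded domains of class `C²` and their outward normals -/

/-- `ρ` is a `C²` defining function of `Ω` on the open neighbourhood `U` of `x₀`: there `Ω` is
`{ρ < 0}`, and the gradient of `ρ` does not vanish at `x₀`. -/
structure IsLocalDefiningFunction {N : ℕ} (Ω : Set (Space N)) (x₀ : Space N)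
    (U : Set (Space N)) (ρ : Space N → ℝ) : Prop where
  isOpen : IsOpen U
  mem : x₀ ∈ U
  contDiffOn : ContDiffOn ℝ 2 ρ U
  mem_iff : ∀ y ∈ U, (y ∈ Ω ↔ ρ y < 0)
  gradient_ne_zero : gradient ρ x₀ ≠ 0

/-- A bounded domain (nonempty, open, connected) with boundary of class `C²`. As the boundary is
compact, the regularity is automatically uniform. -/
structure IsBoundedC2Domain {N : ℕ} (Ω : Set (Space N)) : Prop where
  isOpen : IsOpen Ω
  isConnected : IsConnected Ω
  isBounded : Bornology.IsBounded Ω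
  boundary : ∀ x₀ ∈ frontier Ω, ∃ U ρ, IsLocalDefiningFunction Ω x₀ U ρ

/-- `ν` is the outward unit normal to `Ω` at the boundary point `x₀`, i.e. `∇ρ / |∇ρ|` for a local
defining function `ρ` (it does not depend on the choice of `ρ`). -/
def IsOutwardUnitNormal {N : ℕ} (Ω : Set (Space N)) (x₀ ν : Space N) : Prop :=
  ∃ U ρ, IsLocalDefiningFunction Ω x₀ U ρ ∧ ν = ‖gradient ρ x₀‖⁻¹ • gradient ρ x₀

/-! ### Function spaces -/

/-- `C(Ω̄)` with the supremum norm (`Ω̄` is compact when `Ω` is bounded, and then every continuous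
function on it is bounded). -/
abbrev CBar {N : ℕ} (Ω : Set (Space N)) : Type := closure Ω →ᵇ ℝ

open scoped Classical in
/-- A function on `Ω̄`, regarded as a function on `ℝᴺ` that vanishes outside `Ω̄`; it is only
ever used on `Ω`. -/
def zeroExt {N : ℕ} {Ω : Set (Space N)} (v : CBar Ω) (x : Space N) : ℝ :=
  if h : x ∈ closure Ω then v ⟨x, h⟩ else 0

/-- Test functions on `Ω`: smooth, with compact support contained in `Ω`. -/
structure IsTestFunction {N : ℕ} (Ω : Set (Space N)) (φ : Space N → ℝ) : Prop where
  contDiff : ContDiff ℝ ∞ φ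
  hasCompactSupport : HasCompactSupport φ
  tsupport_subset : tsupport φ ⊆ Ω

/-- The partial derivative `∂ᵢ φ`. -/
def partialDeriv {N : ℕ} (i : Fin N) (φ : Space N → ℝ) (x : Space N) : ℝ :=
  fderiv ℝ φ x (EuclideanSpace.single i 1)

/-- `g` is the weak partial derivative `∂ᵢ f` on `Ω` (for locally integrable `f` and `g`). -/
def HasWeakPartialDeriv {N : ℕ} (Ω : Set (Space N)) (i : Fin N) (f g : Space N → ℝ) : Prop :=
  ∀ φ, IsTestFunction Ω φ →
    ∫ x in Ω, f x * partialDeriv i φ x = - ∫ x in Ω, g x * φ x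

/-- The Sobolev space `W^{2,q}(Ω)`: the function and its weak derivatives of order one and two lie
in `L^q(Ω)`. -/
def MemW2 {N : ℕ} (Ω : Set (Space N)) (q : ℝ) (f : Space N → ℝ) : Prop :=
  MemLp f (ENNReal.ofReal q) (volume.restrict Ω) ∧
  ∃ (g : Fin N → Space N → ℝ) (h : Fin N → Fin N → Space N → ℝ),
    (∀ i, HasWeakPartialDeriv Ω i f (g i)) ∧
    (∀ i, MemLp (g i) (ENNReal.ofReal q) (volume.restrict Ω)) ∧
    (∀ i j, HasWeakPartialDeriv Ω j (g i) (h i j)) ∧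
    (∀ i j, MemLp (h i j) (ENNReal.ofReal q) (volume.restrict Ω))

/-- `Δ f = w` on `Ω` in the sense of distributions. -/
def HasWeakLaplacian {N : ℕ} (Ω : Set (Space N)) (f w : Space N → ℝ) : Prop :=
  ∀ φ, IsTestFunction Ω φ →
    ∫ x in Ω, f x * ∑ i, partialDeriv i (partialDeriv i φ) x = ∫ x in Ω, w x * φ x

/-- The boundary condition `∂f/∂n = 0` on `∂Ω` in the classical sense: the gradient of `f` on `Ω`
has a continuous extension `G` to `Ω̄`, and `G · ν = 0` on `∂Ω`. (For `q > N` and a bounded `C²`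
domain, functions in `W^{2,q}(Ω)` are of class `C¹` up to the boundary, which is what gives the
boundary condition a pointwise meaning.) -/
def NeumannCondition {N : ℕ} (Ω : Set (Space N)) (f : Space N → ℝ) : Prop :=
  ∃ G : Space N → Space N, ContinuousOn G (closure Ω) ∧
    (∀ x ∈ Ω, HasGradientAt f (G x) x) ∧
    ∀ x ∈ frontier Ω, ∀ ν, IsOutwardUnitNormal Ω x ν → inner ℝ (G x) ν = 0

/-- `v` belongs to the domain `D = ⋃_{N < q < ∞} D^q` of the Neumann Laplacian in `C(Ω̄)`, and
`Δ v = w ∈ C(Ω̄)`. Here `D^q` consists of the `v ∈ C(Ω̄) ∩ W^{2,q}(Ω)` with `Δ v ∈ C(Ω̄)` and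
`∂v/∂n = 0` on `∂Ω`. -/
def HasNeumannLaplacian {N : ℕ} (Ω : Set (Space N)) (v w : CBar Ω) : Prop :=
  (∃ q : ℝ, (N : ℝ) < q ∧ MemW2 Ω q (zeroExt v)) ∧
    HasWeakLaplacian Ω (zeroExt v) (zeroExt w) ∧ NeumannCondition Ω (zeroExt v)

/-! ### Solutions and energy -/

/-- `u` is a solution on `[0, T)`, `0 < T ≤ ∞`, of
`u_t - Δu = |u|^p - ⨍_Ω |u|^p` in `Ω`, `∂u/∂n = 0` on `∂Ω`, `u(0) = u₀`, where `⨍_Ω u₀ = 0`,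
in the class `C([0,T); C(Ω̄)) ∩ C¹((0,T); C(Ω̄)) ∩ C((0,T); D)`, where `D` carries the graph
norm. The functions `u'` and `w` are `u_t` and `Δu`. -/
def IsSolution {N : ℕ} (Ω : Set (Space N)) (p : ℝ) (T : EReal) (u₀ : CBar Ω)
    (u : ℝ → CBar Ω) : Prop :=
  0 < T ∧ u 0 = u₀ ∧ ⨍ x in Ω, zeroExt u₀ x = 0 ∧
  ContinuousOn u {t : ℝ | 0 ≤ t ∧ (t : EReal) < T} ∧
  ∃ u' w : ℝ → CBar Ω,
    ContinuousOn u' {t : ℝ | 0 < t ∧ (t : EReal) < T} ∧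
    ContinuousOn w {t : ℝ | 0 < t ∧ (t : EReal) < T} ∧
    ∀ t : ℝ, 0 < t → (t : EReal) < T →
      HasDerivAt u (u' t) t ∧
      HasNeumannLaplacian Ω (u t) (w t) ∧
      ∀ x ∈ Ω, zeroExt (u' t) x - zeroExt (w t) x
        = |zeroExt (u t) x| ^ p - ⨍ y in Ω, |zeroExt (u t) y| ^ p

/-- The energy `E(v) = ∫_Ω (½ |∇v|² - v |v|^p / (p + 1))`. -/
def energy {N : ℕ} (Ω : Set (Space N)) (p : ℝ) (v : CBar Ω) : ℝ :=
  ∫ x in Ω, (1 / 2 * ‖gradient (zeroExt v) x‖ ^ 2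
    - 1 / (p + 1) * (zeroExt v x * |zeroExt v x| ^ p))

end

end NonlocalHeat

/-!
The energy decays because along a solution `d/dt E(u(t)) = -∫_Ω u_t²` (`hasDerivAt_energy`):
formally the derivative is `-∫_Ω (Δu + |u|^p) u_t = -∫_Ω (u_t + m) u_t` with `m` the mean of
`|u|^p`, and `∫_Ω u_t = 0`, since both `Δu` and `|u|^p - m` have mean zero.

As `u_t` is only known to be in `C(Ω̄)`, the Dirichlet integral cannot be differentiated under the
integral sign. Instead, Green's identity applied to two times `s`, `t` gives
`∫ |∇u(s)|² - ∫ |∇u(t)|² = -∫ (Δu(s) + Δu(t)) (u(s) - u(t))`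
(`HasNeumannLaplacian.integral_norm_gradient_sq_eq`), whose right-hand side is differentiable in `s`
at `s = t` when `u` is differentiable and `Δu` continuous with values in `C(Ω̄)`.

The analytic core is therefore Green's identity `∫_Ω (∇u · ∇v + Δu v) = 0`
(`greenDefect_eq_zero`), with `Δu` a distributional Laplacian and `v` a `C¹` function on `Ω` that is
bounded together with its gradient. For `v` compactly supported in `Ω` it follows by mollification.
Near a boundary point with defining function `ρ` one
tests with `v η(ρ / ε)`, where `η(ρ / ε)` vanishes for `ρ ≥ -ε` and is `1` for `ρ ≤ -2ε`. The error
terms live on the collar `{-2ε ≤ ρ ≤ 0}`, which has measure `O(ε)` (`exists_measure_collar_le`),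
and the one carrying the factor `1 / ε` also contains `∇u · ∇ρ`, which tends to zero uniformly by
the Neumann condition (`exists_forall_abs_fderiv_le`). Finitely many bump functions combine the
local identities.
-/

namespace NonlocalHeat

/-! ### Collar estimate for a regular level set -/

/-- Near a regular point of `ρ` the collar `{-2ε ≤ ρ ≤ 0}` has measure `O(ε)`: about `1 / ε`
disjoint translates of it in the direction of the gradient fit into a fixed ball. -/
theorem exists_measure_collar_le {N : ℕ} {ρ : Space N → ℝ} {x₀ : Space N}
    (hρ : ContDiffAt ℝ 2 ρ x₀) (hg : gradient ρ x₀ ≠ 0) :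
    ∃ r₀ > 0, ∀ r ≤ r₀, ContinuousOn ρ (Metric.closedBall x₀ r) →
      ∃ C : ℝ, ∀ ε : ℝ, 0 < ε → ε ≤ 1 →
        volume.real (Metric.closedBall x₀ r ∩ ρ ⁻¹' Icc (-(2 * ε)) 0) ≤ C * ε := by
  set e := gradient ρ x₀ with he
  have he0 : 0 < ‖e‖ := norm_pos_iff.2 hg
  set c : ℝ := ‖e‖ ^ 2 / 2 with hc
  have hc0 : 0 < c := by positivity
  have hst : HasStrictFDerivAt ρ (fderiv ℝ ρ x₀) x₀ := hρ.hasStrictFDerivAt (by norm_num)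
  -- Along `e` the function `ρ` grows at rate at least `c` near `x₀`.
  have hev : ∀ᶠ q : Space N × Space N in 𝓝 (x₀, x₀), ∀ s : ℝ, 0 ≤ s → q.1 = q.2 + s • e →
      ρ q.2 + s * c ≤ ρ q.1 := by
    have := hst.isLittleO.def (show (0 : ℝ) < 1 / 2 * ‖e‖ by positivity)
    filter_upwards [this] with q hq s hs hqs
    have h1 : q.1 - q.2 = s • e := by rw [hqs]; abel
    have h2 : fderiv ℝ ρ x₀ e = ‖e‖ ^ 2 := by
      have : fderiv ℝ ρ x₀ e = inner ℝ (gradient ρ x₀) e := by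
        simp [gradient]
      rw [this, ← he, real_inner_self_eq_norm_sq]
    rw [h1, map_smul, h2, norm_smul, Real.norm_eq_abs, Real.norm_eq_abs, abs_of_nonneg hs,
      smul_eq_mul] at hq
    have h3 := (abs_le.1 hq).1
    rw [hc]
    nlinarith
  obtain ⟨r₁, hr₁, hr⟩ := Metric.eventually_nhds_iff_ball.1 hev
  refine ⟨r₁ / 2, by positivity, fun r hrr hcont => ?_⟩
  refine ⟨volume.real (Metric.closedBall x₀ (r + 6 / c * ‖e‖)), fun ε hε hε1 => ?_⟩
  set A := Metric.closedBall x₀ r ∩ ρ ⁻¹' Icc (-(2 * ε)) 0 with hA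
  have hAc : IsClosed A :=
    hcont.preimage_isClosed_of_isClosed Metric.isClosed_closedBall isClosed_Icc
  set s : ℝ := 3 * ε / c with hs
  have hs0 : 0 < s := by positivity
  set n : ℕ := ⌈1 / ε⌉₊ with hn
  have hn1 : 1 / ε ≤ n := Nat.le_ceil _
  have hn2 : (n : ℝ) < 1 / ε + 1 := Nat.ceil_lt_add_one (by positivity)
  -- The translates of the collar by multiples of `s • e` are disjoint, as `ρ` gains `3 * ε` in
  -- each step and its values on the collar differ by at most `2 * ε`.
  have hmeas : ∀ k : ℕ, MeasurableSet ((fun x => x + ((k : ℝ) * s) • e) '' A) := fun k =>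
    ((Homeomorph.addRight (((k : ℝ) * s) • e)).isClosedMap A hAc).measurableSet
  have key : ∀ k l : ℕ, k < l →
      Disjoint ((fun x => x + ((k : ℝ) * s) • e) '' A) ((fun x => x + ((l : ℝ) * s) • e) '' A) := by
    intro k l hkl
    rw [Set.disjoint_left]
    rintro _ ⟨x, hx, rfl⟩ ⟨y, hy, hxy⟩
    have hxy' : x = y + (((l : ℝ) - k) * s) • e := by
      have : x = y + ((l : ℝ) * s) • e - ((k : ℝ) * s) • e := by
        simp only at hxy; rw [hxy]; abel
      rw [this, sub_mul, sub_smul]; abel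
    have hkl' : (1 : ℝ) ≤ (l : ℝ) - k := by
      have : (k : ℝ) + 1 ≤ l := by exact_mod_cast hkl
      linarith
    have hball : (x, y) ∈ Metric.ball (x₀, x₀) r₁ := by
      rw [← ball_prod_same]
      exact ⟨Metric.closedBall_subset_ball (by linarith) hx.1,
        Metric.closedBall_subset_ball (by linarith) hy.1⟩
    have h := hr (x, y) hball (((l : ℝ) - k) * s) (by nlinarith) hxy'
    have h1 := hx.2.2
    have h2 := hy.2.1
    have h3 : s * c = 3 * ε := by rw [hs]; field_simp
    simp only at h
    nlinarith
  have hdisj : (↑(Finset.range n) : Set ℕ).PairwiseDisjoint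
      (fun k : ℕ => (fun x => x + ((k : ℝ) * s) • e) '' A) := by
    intro k _ l _ hkl
    rcases lt_or_gt_of_ne hkl with h | h
    · exact key k l h
    · exact (key l k h).symm
  have hsub : (⋃ k ∈ Finset.range n, (fun x => x + ((k : ℝ) * s) • e) '' A) ⊆
      Metric.closedBall x₀ (r + 6 / c * ‖e‖) := by
    refine iUnion₂_subset fun k hk => ?_
    rintro _ ⟨x, hx, rfl⟩
    have hk' : (k : ℝ) ≤ n := by exact_mod_cast (Finset.mem_range.1 hk).le
    have h1 : (k : ℝ) * s ≤ 6 / c := by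
      have : (1 / ε + 1) * s ≤ 6 / c := by
        rw [hs, show (1 / ε + 1) * (3 * ε / c) = (3 + 3 * ε) / c by field_simp]
        gcongr; linarith
      refine le_trans ?_ this
      gcongr; linarith
    have hx1 := hx.1
    rw [Metric.mem_closedBall, dist_eq_norm] at hx1 ⊢
    calc ‖x + ((k : ℝ) * s) • e - x₀‖ = ‖(x - x₀) + ((k : ℝ) * s) • e‖ := by congr 1; abel
      _ ≤ ‖x - x₀‖ + ‖((k : ℝ) * s) • e‖ := norm_add_le _ _
      _ ≤ r + 6 / c * ‖e‖ := by
        rw [norm_smul, Real.norm_eq_abs, abs_of_nonneg (by positivity)]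
        gcongr
  have hvol : ∀ k : ℕ, volume ((fun x => x + ((k : ℝ) * s) • e) '' A) = volume A := fun k => by
    rw [image_add_right, measure_preimage_add_right]
  have hle := measureReal_mono (μ := volume) hsub measure_closedBall_lt_top.ne
  rw [measureReal_def, measure_biUnion_finset hdisj (fun k _ => hmeas k)] at hle
  simp only [hvol, Finset.sum_const, Finset.card_range, nsmul_eq_mul, ENNReal.toReal_mul,
    ENNReal.toReal_natCast] at hle
  rw [← measureReal_def] at hle
  have h0 : 0 ≤ volume.real A := measureReal_nonneg
  have : 1 / ε * volume.real A ≤ volume.real (Metric.closedBall x₀ (r + 6 / c * ‖e‖)) :=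
    (mul_le_mul_of_nonneg_right hn1 h0).trans hle
  rw [one_div, inv_mul_le_iff₀ hε] at this
  linarith

theorem eq_zero_of_forall_abs_le_mul {a B : ℝ} (h : ∀ δ > 0, |a| ≤ δ * B) : a = 0 := by
  have ht : Tendsto (fun δ : ℝ => δ * B) (𝓝[>] 0) (𝓝 0) := by
    have : Tendsto (fun δ : ℝ => δ * B) (𝓝 0) (𝓝 (0 * B)) := tendsto_id.mul_const B
    rw [zero_mul] at this
    exact this.mono_left nhdsWithin_le_nhds
  have := ge_of_tendsto ht (eventually_mem_nhdsWithin.mono fun δ hδ => h δ hδ)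
  exact abs_eq_zero.1 (le_antisymm this (abs_nonneg a))

/-! ### Test functions and compactly supported `C¹` functions -/

theorem contDiff_of_contDiffAt_tsupport {N : ℕ} {n : ℕ∞} {f : Space N → ℝ}
    (hf : ∀ x ∈ tsupport f, ContDiffAt ℝ n f x) : ContDiff ℝ n f := by
  rw [contDiff_iff_contDiffAt]
  intro x
  by_cases hx : x ∈ tsupport f
  · exact hf x hx
  · exact contDiffAt_const.congr_of_eventuallyEq (notMem_tsupport_iff_eventuallyEq.1 hx)

/-- Test functions are dense in `C¹_c(Ω)` for the `C¹` norm, by mollification. -/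
theorem exists_testFunction_approx {N : ℕ} {Ω : Set (Space N)} (hΩ : IsOpen Ω) {ψ : Space N → ℝ}
    (hψ : ContDiff ℝ 1 ψ) (hc : HasCompactSupport ψ) (hs : tsupport ψ ⊆ Ω) {δ : ℝ} (hδ : 0 < δ) :
    ∃ φ, IsTestFunction Ω φ ∧
      ∀ x, |φ x - ψ x| ≤ δ ∧ ‖fderiv ℝ φ x - fderiv ℝ ψ x‖ ≤ δ := by
  have hψ' : Continuous (fderiv ℝ ψ) := hψ.continuous_fderiv (by norm_num)
  have hu1 := hc.uniformContinuous_of_continuous hψ.continuous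
  have hu2 := (hc.fderiv (𝕜 := ℝ)).uniformContinuous_of_continuous hψ'
  obtain ⟨d₁, hd₁, h1⟩ := Metric.uniformContinuous_iff.1 hu1 δ hδ
  obtain ⟨d₂, hd₂, h2⟩ := Metric.uniformContinuous_iff.1 hu2 δ hδ
  obtain ⟨d₃, hd₃, h3⟩ := hc.isCompact.exists_cthickening_subset_open hΩ hs
  set d := min d₁ (min d₂ d₃) with hd
  have hd0 : 0 < d := by positivity
  let β : ContDiffBump (0 : Space N) := ⟨d / 2, d, by positivity, by linarith⟩
  have hβ : β.rOut = d := rfl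
  have hn : HasCompactSupport (β.normed volume) := β.hasCompactSupport_normed
  have hcd : ContDiff ℝ ∞ (β.normed volume) := β.contDiff_normed
  have hli : LocallyIntegrable (β.normed volume) volume := β.continuous_normed.locallyIntegrable
  set φ := convolution (β.normed volume) ψ (ContinuousLinearMap.lsmul ℝ ℝ) volume with hφ
  have hfd : ∀ x, fderiv ℝ φ x =
      convolution (β.normed volume) (fderiv ℝ ψ) (ContinuousLinearMap.lsmul ℝ ℝ) volume x := by
    intro x
    -- The derivative falls on `ψ`, so that `fderiv ℝ φ` is the mollification of `fderiv ℝ ψ`.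
    rw [(hc.hasFDerivAt_convolution_right (ContinuousLinearMap.lsmul ℝ ℝ) hli hψ x).fderiv]
    rfl
  refine ⟨φ, ⟨?_, ?_, ?_⟩, fun x => ⟨?_, ?_⟩⟩
  · exact hn.contDiff_convolution_left _ hcd hψ.continuous.locallyIntegrable
  · exact hn.convolution _ hc
  · refine subset_trans ?_ h3
    refine closure_minimal ?_ Metric.isClosed_cthickening
    refine (support_convolution_subset _).trans ?_
    rintro _ ⟨a, ha, b, hb, rfl⟩
    rw [β.support_normed_eq] at ha
    refine Metric.mem_cthickening_of_dist_le (a + b) b _ _ (subset_closure hb) ?_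
    have : dist (a + b) b = ‖a‖ := by rw [dist_eq_norm, add_sub_cancel_right]
    rw [this]
    have h := mem_ball_zero_iff.1 ha
    exact (h.le.trans (min_le_right _ _)).trans (min_le_right _ _)
  · rw [← Real.dist_eq]
    refine ContDiffBump.dist_normed_convolution_le hψ.continuous.aestronglyMeasurable ?_
    intro y hy
    exact (h1 (lt_of_lt_of_le hy (min_le_left _ _))).le
  · rw [← dist_eq_norm, hfd]
    refine ContDiffBump.dist_normed_convolution_le hψ'.aestronglyMeasurable ?_
    intro y hy
    exact (h2 (lt_of_lt_of_le hy ((min_le_right _ _).trans (min_le_left _ _)))).le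

theorem contDiff_partialDeriv {N : ℕ} {φ : Space N → ℝ} (hφ : ContDiff ℝ ∞ φ) (i : Fin N) :
    ContDiff ℝ ∞ (partialDeriv i φ) :=
  (hφ.fderiv_right (m := ∞) (by norm_num)).clm_apply contDiff_const

theorem tsupport_partialDeriv_subset {N : ℕ} (φ : Space N → ℝ) (i : Fin N) :
    tsupport (partialDeriv i φ) ⊆ tsupport φ :=
  tsupport_fderiv_apply_subset ℝ _

theorem continuous_mul_of_tsupport_subset {N : ℕ} {Ω : Set (Space N)} (hΩ : IsOpen Ω)
    {f g : Space N → ℝ} (hf : ContinuousOn f Ω) (hg : Continuous g) (hs : tsupport g ⊆ Ω) :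
    Continuous fun x => f x * g x := by
  refine continuous_of_tsupport fun x hx => ?_
  have hx' : x ∈ tsupport g := closure_mono (fun y hy => right_ne_zero_of_mul hy) hx
  exact (hf.continuousAt (hΩ.mem_nhds (hs hx'))).mul hg.continuousAt

/-- Integration by parts against a compactly supported factor. The function `f` is arbitrary outside
`Ω`. -/
theorem integral_mul_partialDeriv {N : ℕ} {Ω : Set (Space N)} (hΩ : IsOpen Ω) {f φ : Space N → ℝ}
    (hf : ContDiffOn ℝ 1 f Ω) (hφ : ContDiff ℝ 1 φ) (hc : HasCompactSupport φ)
    (hs : tsupport φ ⊆ Ω) (i : Fin N) :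
    ∫ x in Ω, f x * partialDeriv i φ x = - ∫ x in Ω, partialDeriv i f x * φ x := by
  have hz : ∀ (g h : Space N → ℝ), tsupport h ⊆ Ω → ∀ x ∉ Ω, g x * h x = 0 := fun g h hh x hx => by
    rw [image_eq_zero_of_notMem_tsupport (fun h' => hx (hh h')), mul_zero]
  have hs' : tsupport (partialDeriv i φ) ⊆ Ω := (tsupport_partialDeriv_subset φ i).trans hs
  have hfc : ContinuousOn (partialDeriv i f) Ω :=
    (hf.continuousOn_fderiv_of_isOpen hΩ le_rfl).clm_apply continuousOn_const
  have hφc : Continuous (partialDeriv i φ) :=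
    (hφ.continuous_fderiv (by norm_num)).clm_apply continuous_const
  have hc' : HasCompactSupport (partialDeriv i φ) :=
    hc.of_isClosed_subset (isClosed_tsupport _) (tsupport_partialDeriv_subset φ i)
  rw [setIntegral_eq_integral_of_forall_compl_eq_zero (hz _ _ hs'),
    setIntegral_eq_integral_of_forall_compl_eq_zero (hz _ _ hs)]
  refine integral_mul_fderiv_eq_neg_fderiv_mul_of_integrable ?_ ?_ ?_ ?_ ?_
  · exact (continuous_mul_of_tsupport_subset hΩ hfc
      hφ.continuous hs).integrable_of_hasCompactSupport hc.mul_left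
  · exact (continuous_mul_of_tsupport_subset hΩ hf.continuousOn
      hφc hs').integrable_of_hasCompactSupport hc'.mul_left
  · exact (continuous_mul_of_tsupport_subset hΩ hf.continuousOn
      hφ.continuous hs).integrable_of_hasCompactSupport hc.mul_left
  · exact fun x hx => (hf.contDiffAt (hΩ.mem_nhds (hs hx))).differentiableAt (by norm_num)
  · exact fun x _ => (hφ.differentiable (by norm_num)) x

theorem fderiv_apply_eq_sum_partialDeriv {N : ℕ} (φ : Space N → ℝ) (x y : Space N) :
    fderiv ℝ φ x y = ∑ i, y i * partialDeriv i φ x := by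
  have h : y = ∑ i, y i • EuclideanSpace.single i (1 : ℝ) := by
    conv_lhs => rw [← (EuclideanSpace.basisFun (Fin N) ℝ).sum_repr y]
    simp
  conv_lhs => rw [h]
  simp [partialDeriv]

/-! ### Bounded `C¹` functions -/

/-- `v` is continuously differentiable in `Ω`, and `v` and its gradient are bounded there. Nothing
is required of `v` outside `Ω` or on the boundary. -/
structure IsC1Bounded {N : ℕ} (Ω : Set (Space N)) (v : Space N → ℝ) : Prop where
  contDiffOn : ContDiffOn ℝ 1 v Ω
  bounded : ∃ C : ℝ, ∀ x ∈ Ω, |v x| ≤ C ∧ ‖fderiv ℝ v x‖ ≤ C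

theorem IsC1Bounded.of_hasCompactSupport {N : ℕ} {Ω : Set (Space N)} {v : Space N → ℝ}
    (hv : ContDiff ℝ 1 v) (hc : HasCompactSupport v) : IsC1Bounded Ω v := by
  obtain ⟨C, hC⟩ := hc.exists_bound_of_continuous hv.continuous
  obtain ⟨C', hC'⟩ := (hc.fderiv (𝕜 := ℝ)).exists_bound_of_continuous
    (hv.continuous_fderiv (by norm_num))
  exact ⟨hv.contDiffOn, max C C', fun x _ =>
    ⟨(hC x).trans (le_max_left _ _), (hC' x).trans (le_max_right _ _)⟩⟩

theorem IsC1Bounded.const {N : ℕ} (Ω : Set (Space N)) (c : ℝ) : IsC1Bounded Ω fun _ => c :=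
  ⟨contDiffOn_const, |c|, fun x _ => ⟨le_rfl, by simp⟩⟩

theorem IsC1Bounded.differentiableAt {N : ℕ} {Ω : Set (Space N)} {v : Space N → ℝ}
    (hv : IsC1Bounded Ω v) (hΩ : IsOpen Ω) {x : Space N} (hx : x ∈ Ω) : DifferentiableAt ℝ v x :=
  (hv.contDiffOn.contDiffAt (hΩ.mem_nhds hx)).differentiableAt (by norm_num)

theorem IsC1Bounded.mul {N : ℕ} {Ω : Set (Space N)} {u v : Space N → ℝ} (hu : IsC1Bounded Ω u)
    (hv : IsC1Bounded Ω v) (hΩ : IsOpen Ω) : IsC1Bounded Ω fun x => u x * v x := by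
  obtain ⟨A, hA⟩ := hu.bounded
  obtain ⟨B, hB⟩ := hv.bounded
  refine ⟨hu.contDiffOn.mul hv.contDiffOn, max (A * B) (A * B + B * A), fun x hx => ?_⟩
  have hA0 : 0 ≤ A := (abs_nonneg _).trans (hA x hx).1
  have hB0 : 0 ≤ B := (abs_nonneg _).trans (hB x hx).1
  constructor
  · rw [abs_mul]
    exact (mul_le_mul (hA x hx).1 (hB x hx).1 (abs_nonneg _) hA0).trans (le_max_left _ _)
  · rw [fderiv_fun_mul (hu.differentiableAt hΩ hx) (hv.differentiableAt hΩ hx)]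
    refine le_trans ((norm_add_le _ _).trans (add_le_add ?_ ?_)) (le_max_right _ _)
    · rw [norm_smul]
      exact mul_le_mul (hA x hx).1 (hB x hx).2 (norm_nonneg _) hA0
    · rw [norm_smul]
      exact mul_le_mul (hB x hx).1 (hA x hx).2 (norm_nonneg _) hB0

theorem IsC1Bounded.sub {N : ℕ} {Ω : Set (Space N)} {u v : Space N → ℝ} (hu : IsC1Bounded Ω u)
    (hv : IsC1Bounded Ω v) (hΩ : IsOpen Ω) : IsC1Bounded Ω fun x => u x - v x := by
  obtain ⟨A, hA⟩ := hu.bounded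
  obtain ⟨B, hB⟩ := hv.bounded
  refine ⟨hu.contDiffOn.sub hv.contDiffOn, A + B, fun x hx => ⟨?_, ?_⟩⟩
  · exact (abs_sub _ _).trans (add_le_add (hA x hx).1 (hB x hx).1)
  · rw [fderiv_fun_sub (hu.differentiableAt hΩ hx) (hv.differentiableAt hΩ hx)]
    exact (norm_sub_le _ _).trans (add_le_add (hA x hx).2 (hB x hx).2)

theorem IsC1Bounded.integrableOn_greenDefect {N : ℕ} {Ω : Set (Space N)} {v : Space N → ℝ}
    (hv : IsC1Bounded Ω v) (hΩ : IsOpen Ω) {G : Space N → Space N} {w : Space N → ℝ}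
    (hG : IntegrableOn G Ω) (hw : IntegrableOn w Ω) :
    IntegrableOn (fun x => fderiv ℝ v x (G x) + w x * v x) Ω := by
  obtain ⟨C, hC⟩ := hv.bounded
  have hae : ∀ᵐ x ∂volume.restrict Ω, x ∈ Ω := ae_restrict_mem hΩ.measurableSet
  refine Integrable.add ?_ (Integrable.mul_bdd (c := C) hw
    (hv.contDiffOn.continuousOn.aestronglyMeasurable hΩ.measurableSet)
    (hae.mono fun x hx => (hC x hx).1))
  refine Integrable.mono' (hG.norm.const_mul C) ?_ (hae.mono fun x hx => ?_)
  · exact (ContinuousLinearMap.apply ℝ ℝ).flip.aestronglyMeasurable_comp₂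
      ((hv.contDiffOn.continuousOn_fderiv_of_isOpen hΩ le_rfl).aestronglyMeasurable
        hΩ.measurableSet) hG.aestronglyMeasurable
  · exact (ContinuousLinearMap.le_opNorm _ _).trans (by gcongr; exact (hC x hx).2)

/-! ### The defect in Green's identity -/

/-- The defect `∫_Ω (∇v · G + w v)` in Green's identity for a vector field `G` with divergence `w`
and vanishing normal component on `∂Ω`; the gradient of `v` enters through the Fréchet
derivative. -/
noncomputable def greenDefect {N : ℕ} (Ω : Set (Space N)) (G : Space N → Space N)
    (w v : Space N → ℝ) : ℝ :=
  ∫ x in Ω, (fderiv ℝ v x (G x) + w x * v x)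

theorem integrableOn_of_continuousOn_closure {N : ℕ} {Ω : Set (Space N)} {E : Type*}
    [NormedAddCommGroup E] (hb : Bornology.IsBounded Ω) {f : Space N → E}
    (hf : ContinuousOn f (closure Ω)) : IntegrableOn f Ω :=
  (hf.integrableOn_compact hb.isCompact_closure).mono_set subset_closure

theorem contDiffOn_one_of_hasGradientAt {N : ℕ} {Ω : Set (Space N)} (hΩ : IsOpen Ω)
    {f : Space N → ℝ} {G : Space N → Space N} (hG : ContinuousOn G Ω)
    (hf : ∀ x ∈ Ω, HasGradientAt f (G x) x) : ContDiffOn ℝ 1 f Ω := by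
  rw [show (1 : WithTop ℕ∞) = 0 + 1 by norm_num, contDiffOn_succ_iff_fderiv_of_isOpen hΩ]
  refine ⟨fun x hx => (hf x hx).hasFDerivAt.differentiableAt.differentiableWithinAt,
    by simp, ?_⟩
  rw [contDiffOn_zero]
  exact ((InnerProductSpace.toDual ℝ (Space N)).continuous.comp_continuousOn hG).congr
    fun x hx => (hf x hx).hasFDerivAt.fderiv

theorem greenDefect_testFunction {N : ℕ} {Ω : Set (Space N)} (hΩ : IsOpen Ω) {f w : Space N → ℝ}
    {G : Space N → Space N} (hG : ContinuousOn G Ω) (hw : IntegrableOn w Ω)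
    (hf : ∀ x ∈ Ω, HasGradientAt f (G x) x)
    (hlap : HasWeakLaplacian Ω f w) {φ : Space N → ℝ} (hφ : IsTestFunction Ω φ) :
    greenDefect Ω G w φ = 0 := by
  have hfd : ∀ x ∈ Ω, fderiv ℝ f x = InnerProductSpace.toDual ℝ _ (G x) := fun x hx =>
    (hf x hx).hasFDerivAt.fderiv
  have hf1 := contDiffOn_one_of_hasGradientAt hΩ hG hf
  have hpd : ∀ i, ∀ x ∈ Ω, partialDeriv i f x = G x i := fun i x hx => by
    rw [partialDeriv, hfd x hx, InnerProductSpace.toDual_apply_apply,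
      EuclideanSpace.inner_single_right]
    simp
  have hGi : ∀ i, ContinuousOn (fun x => G x i) Ω := fun i =>
    ((EuclideanSpace.proj i : Space N →L[ℝ] ℝ).continuous.comp_continuousOn hG)
  have hpc : ∀ i, HasCompactSupport (partialDeriv i φ) := fun i =>
    hφ.hasCompactSupport.of_isClosed_subset (isClosed_tsupport _) (tsupport_partialDeriv_subset φ i)
  have hps : ∀ i, tsupport (partialDeriv i φ) ⊆ Ω := fun i =>
    (tsupport_partialDeriv_subset φ i).trans hφ.tsupport_subset
  have hint1 : ∀ i, IntegrableOn (fun x => G x i * partialDeriv i φ x) Ω := fun i =>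
    ((continuous_mul_of_tsupport_subset hΩ (hGi i) (contDiff_partialDeriv hφ.contDiff i).continuous
      (hps i)).integrable_of_hasCompactSupport (hpc i).mul_left).integrableOn
  have hint2 : ∀ i, IntegrableOn (fun x => f x * partialDeriv i (partialDeriv i φ) x) Ω := fun i =>
    ((continuous_mul_of_tsupport_subset hΩ hf1.continuousOn
      (contDiff_partialDeriv (contDiff_partialDeriv hφ.contDiff i) i).continuous
      ((tsupport_partialDeriv_subset _ i).trans (hps i))).integrable_of_hasCompactSupport
      (HasCompactSupport.mul_left ((hpc i).of_isClosed_subset (isClosed_tsupport _)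
        (tsupport_partialDeriv_subset _ i)))).integrableOn
  have hint3 : IntegrableOn (fun x => w x * φ x) Ω := by
    obtain ⟨C, hC⟩ := hφ.hasCompactSupport.exists_bound_of_continuous hφ.contDiff.continuous
    exact Integrable.mul_bdd hw hφ.contDiff.continuous.aestronglyMeasurable (ae_of_all _ hC)
  have h := hlap φ hφ
  simp_rw [Finset.mul_sum] at h
  rw [integral_finsetSum _ (fun i _ => hint2 i)] at h
  have hi : ∀ i, ∫ x in Ω, f x * partialDeriv i (partialDeriv i φ) x
      = - ∫ x in Ω, G x i * partialDeriv i φ x := fun i => by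
    rw [integral_mul_partialDeriv hΩ hf1
      ((contDiff_partialDeriv hφ.contDiff i).of_le (by norm_cast))
      (hpc i) (hps i)]
    congr 1
    exact setIntegral_congr_fun hΩ.measurableSet fun x hx => by simp only [hpd i x hx]
  simp_rw [hi, Finset.sum_neg_distrib] at h
  unfold greenDefect
  simp_rw [fderiv_apply_eq_sum_partialDeriv]
  rw [integral_add (integrable_finsetSum _ fun i _ => hint1 i) hint3,
    integral_finsetSum _ (fun i _ => hint1 i), ← h]
  ring

theorem greenDefect_of_compactSupport {N : ℕ} {Ω : Set (Space N)} (hΩ : IsOpen Ω)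
    {G : Space N → Space N} {w : Space N → ℝ} (hG : IntegrableOn G Ω) (hw : IntegrableOn w Ω)
    (h0 : ∀ φ, IsTestFunction Ω φ → greenDefect Ω G w φ = 0) {ψ : Space N → ℝ}
    (hψ : ContDiff ℝ 1 ψ) (hc : HasCompactSupport ψ) (hs : tsupport ψ ⊆ Ω) :
    greenDefect Ω G w ψ = 0 := by
  set B : ℝ := ∫ x in Ω, (‖G x‖ + ‖w x‖) with hB
  have hle : ∀ δ > 0, |greenDefect Ω G w ψ| ≤ δ * B := by
    intro δ hδ
    obtain ⟨φ, hφ, happ⟩ := exists_testFunction_approx hΩ hψ hc hs hδ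
    have hφ1 : ContDiff ℝ 1 φ := hφ.contDiff.of_le (by norm_cast)
    rw [← sub_zero (greenDefect Ω G w ψ), ← h0 φ hφ, greenDefect, greenDefect,
      ← integral_sub
        ((IsC1Bounded.of_hasCompactSupport hψ hc).integrableOn_greenDefect hΩ hG hw)
        ((IsC1Bounded.of_hasCompactSupport hφ1 hφ.hasCompactSupport).integrableOn_greenDefect
          hΩ hG hw), ← Real.norm_eq_abs, hB,
      ← integral_const_mul]
    refine norm_integral_le_of_norm_le ((hG.norm.add hw.norm).const_mul δ) (ae_of_all _ fun x => ?_)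
    have e : fderiv ℝ ψ x (G x) + w x * ψ x - (fderiv ℝ φ x (G x) + w x * φ x)
        = -((fderiv ℝ φ x - fderiv ℝ ψ x) (G x) + w x * (φ x - ψ x)) := by
      rw [sub_apply]; ring
    rw [e, norm_neg, mul_add]
    refine (norm_add_le _ _).trans (add_le_add ?_ ?_)
    · exact (ContinuousLinearMap.le_opNorm _ _).trans (by gcongr; exact (happ x).2)
    · rw [norm_mul, mul_comm]
      gcongr
      exact (happ x).1
  exact eq_zero_of_forall_abs_le_mul hle

/-! ### Localisation at the boundary -/

theorem exists_deriv_smoothTransition_le :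
    ∃ M : ℝ, 0 ≤ M ∧ ∀ s, |deriv Real.smoothTransition s| ≤ M := by
  have hs : HasCompactSupport (deriv Real.smoothTransition) := by
    refine HasCompactSupport.intro (isCompact_Icc (a := (0 : ℝ)) (b := 1)) fun s hs => ?_
    rw [mem_Icc, not_and_or, not_le, not_le] at hs
    rcases hs with hs | hs
    · have : Real.smoothTransition =ᶠ[𝓝 s] fun _ => 0 :=
        (eventually_lt_nhds hs).mono fun y hy => Real.smoothTransition.zero_of_nonpos hy.le
      rw [this.deriv_eq, deriv_const]
    · have : Real.smoothTransition =ᶠ[𝓝 s] fun _ => 1 :=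
        (eventually_gt_nhds hs).mono fun y hy => Real.smoothTransition.one_of_one_le hy.le
      rw [this.deriv_eq, deriv_const]
  obtain ⟨M, hM⟩ := hs.exists_bound_of_continuous
    ((Real.smoothTransition.contDiff (n := 1)).continuous_deriv (by norm_num))
  exact ⟨M, (norm_nonneg _).trans (hM 0), hM⟩

/-- A field which is tangential to `∂Ω` is almost tangential to the level sets of the defining
function `ρ` near `∂Ω`, uniformly on compact sets. -/
theorem exists_forall_abs_fderiv_le {N : ℕ} {Ω K : Set (Space N)} (hK : IsCompact K)
    {ρ : Space N → ℝ} (hρ : ContinuousOn ρ K) (hρ' : ContinuousOn (fderiv ℝ ρ) K)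
    (hneg : ∀ x ∈ K, x ∈ Ω → ρ x < 0) {G : Space N → Space N} (hG : ContinuousOn G (closure Ω))
    (hΩ : IsOpen Ω) (htan : ∀ x ∈ K, x ∈ frontier Ω → fderiv ℝ ρ x (G x) = 0) {δ : ℝ} (hδ : 0 < δ) :
    ∃ ε₁ > 0, ∀ x ∈ Ω ∩ K, -(2 * ε₁) ≤ ρ x → |fderiv ℝ ρ x (G x)| ≤ δ := by
  have hL : IsCompact (closure Ω ∩ K) := hK.inter_left isClosed_closure
  have hcont : ContinuousOn (fun x => |fderiv ℝ ρ x (G x)|) (closure Ω ∩ K) :=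
    ((hρ'.mono inter_subset_right).clm_apply (hG.mono inter_subset_left)).abs
  have hQ : IsCompact ((closure Ω ∩ K) ∩ (fun x => |fderiv ℝ ρ x (G x)|) ⁻¹' Ici δ) :=
    hL.of_isClosed_subset (hcont.preimage_isClosed_of_isClosed hL.isClosed isClosed_Ici)
      inter_subset_left
  set Q := (closure Ω ∩ K) ∩ (fun x => |fderiv ℝ ρ x (G x)|) ⁻¹' Ici δ with hQd
  have hQneg : ∀ x ∈ Q, ρ x < 0 := by
    rintro x ⟨⟨hxc, hxK⟩, hxδ⟩
    by_cases hx : x ∈ Ω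
    · exact hneg x hxK hx
    · have := htan x hxK ⟨hxc, by rwa [hΩ.interior_eq]⟩
      rw [mem_preimage, this, abs_zero, mem_Ici] at hxδ
      linarith
  rcases Q.eq_empty_or_nonempty with he | hne
  · refine ⟨1, one_pos, fun x hx _ => ?_⟩
    by_contra! h
    exact (he ▸ (⟨⟨subset_closure hx.1, hx.2⟩, h.le⟩ : x ∈ Q) : x ∈ (∅ : Set (Space N)))
  · obtain ⟨m, hm, hmax⟩ := hQ.exists_isMaxOn hne (hρ.mono fun x hx => hx.1.2)
    have hm0 := hQneg m hm
    refine ⟨-ρ m / 4, by linarith, fun x hx hxρ => ?_⟩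
    by_contra! h
    have : ρ x ≤ ρ m := hmax (⟨⟨subset_closure hx.1, hx.2⟩, h.le⟩ : x ∈ Q)
    linarith

/-- Green's identity for functions supported near a boundary point, by cutting off along the level
sets of the defining function. -/
theorem greenDefect_eq_zero_near_boundary {N : ℕ} {Ω : Set (Space N)} (hΩ : IsBoundedC2Domain Ω)
    {G : Space N → Space N} {w : Space N → ℝ} (hG : ContinuousOn G (closure Ω))
    (hw : ContinuousOn w (closure Ω))
    (hν : ∀ x ∈ frontier Ω, ∀ ν, IsOutwardUnitNormal Ω x ν → inner ℝ (G x) ν = 0)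
    (h0 : ∀ ψ : Space N → ℝ, ContDiff ℝ 1 ψ → HasCompactSupport ψ → tsupport ψ ⊆ Ω →
      greenDefect Ω G w ψ = 0)
    {x₀ : Space N} (hx₀ : x₀ ∈ frontier Ω) :
    ∃ r > 0, ∀ v, IsC1Bounded Ω v → (∀ x ∉ Metric.closedBall x₀ r, v x = 0) →
      greenDefect Ω G w v = 0 := by
  obtain ⟨U, ρ, hU⟩ := hΩ.boundary x₀ hx₀
  have hΩo := hΩ.isOpen
  have hρ'U : ContinuousOn (fderiv ℝ ρ) U :=
    hU.contDiffOn.continuousOn_fderiv_of_isOpen hU.isOpen (by norm_num)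
  have hUn : U ∈ 𝓝 x₀ := hU.isOpen.mem_nhds hU.mem
  obtain ⟨r₀, hr₀, hcollar⟩ :=
    exists_measure_collar_le (hU.contDiffOn.contDiffAt hUn) hU.gradient_ne_zero
  have hgrad : ∀ᶠ y in 𝓝 x₀, gradient ρ y ≠ 0 := by
    have : ContinuousAt (gradient ρ) x₀ :=
      (InnerProductSpace.toDual ℝ (Space N)).symm.continuous.continuousAt.comp
        (hρ'U.continuousAt hUn)
    exact this.eventually_ne hU.gradient_ne_zero
  obtain ⟨r₁, hr₁, hball⟩ := Metric.nhds_basis_closedBall.mem_iff.1 (inter_mem hUn hgrad)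
  set r := min r₀ r₁ with hr
  set K := Metric.closedBall x₀ r with hK
  have hKc : IsCompact K := isCompact_closedBall x₀ r
  have hKsub : K ⊆ U ∩ {y | gradient ρ y ≠ 0} :=
    (Metric.closedBall_subset_closedBall (min_le_right _ _)).trans hball
  have hKU : K ⊆ U := fun x hx => (hKsub hx).1
  have hρK : ContinuousOn ρ K := hU.contDiffOn.continuousOn.mono hKU
  obtain ⟨C, hC⟩ := hcollar r (min_le_left _ _) hρK
  have hC0 : 0 ≤ C := by
    have := hC 1 one_pos le_rfl
    rw [mul_one C] at this
    exact measureReal_nonneg.trans this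
  have htan : ∀ x ∈ K, x ∈ frontier Ω → fderiv ℝ ρ x (G x) = 0 := by
    intro x hxK hx
    -- `ρ` is a defining function at every boundary point of `K`, not just at `x₀`.
    have hloc : IsLocalDefiningFunction Ω x U ρ :=
      ⟨hU.isOpen, hKU hxK, hU.contDiffOn, hU.mem_iff, (hKsub hxK).2⟩
    have h := hν x hx _ ⟨U, ρ, hloc, rfl⟩
    rw [inner_smul_right, mul_eq_zero] at h
    have h' := h.resolve_left (inv_ne_zero (norm_ne_zero_iff.2 (hKsub hxK).2))
    rw [real_inner_comm] at h'
    simpa [gradient] using h'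
  have hneg : ∀ x ∈ K, x ∈ Ω → ρ x < 0 := fun x hxK hx => (hU.mem_iff x (hKU hxK)).1 hx
  obtain ⟨M, hM0, hM⟩ := exists_deriv_smoothTransition_le
  obtain ⟨Cg, hCg⟩ := hΩ.isBounded.isCompact_closure.exists_bound_of_continuousOn hG
  obtain ⟨Cw, hCw⟩ := hΩ.isBounded.isCompact_closure.exists_bound_of_continuousOn hw
  refine ⟨r, by positivity, fun v hv hvK => ?_⟩
  obtain ⟨B, hB⟩ := hv.bounded
  obtain ⟨z, hz⟩ := hΩ.isConnected.nonempty
  have hB0 : 0 ≤ B := (abs_nonneg _).trans (hB z hz).1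
  have hCg0 : 0 ≤ Cg := (norm_nonneg _).trans (hCg z (subset_closure hz))
  have hCw0 : 0 ≤ Cw := (norm_nonneg _).trans (hCw z (subset_closure hz))
  have hvd : ∀ x ∉ K, fderiv ℝ v x = 0 := by
    intro x hx
    have : v =ᶠ[𝓝 x] fun _ => 0 := by
      filter_upwards [Metric.isClosed_closedBall.isOpen_compl.mem_nhds hx] with y hy
      exact hvK y hy
    rw [this.fderiv_eq]; simp
  refine eq_zero_of_forall_abs_le_mul (B := ((B * Cg + Cw * B) + B * M) * C) fun δ hδ => ?_
  obtain ⟨ε₁, hε₁, hflux⟩ :=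
    exists_forall_abs_fderiv_le hKc hρK (hρ'U.mono hKU) hneg hG hΩo htan hδ
  set ε := min ε₁ (min δ 1) with hε
  have hε0 : 0 < ε := by positivity
  have hεδ : ε ≤ δ := (min_le_right _ _).trans (min_le_left _ _)
  -- `η` vanishes where `-ε ≤ ρ` and is `1` where `ρ ≤ -2ε`.
  set η : Space N → ℝ := fun x => Real.smoothTransition (-ρ x / ε - 1) with hη
  have hη_diff : ∀ x ∈ U, HasFDerivAt η
      ((deriv Real.smoothTransition (-ρ x / ε - 1)) • (-ε⁻¹ • fderiv ℝ ρ x)) x := by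
    intro x hx
    have h1 : HasFDerivAt ρ (fderiv ℝ ρ x) x :=
      ((hU.contDiffOn.contDiffAt (hU.isOpen.mem_nhds hx)).differentiableAt
        (by norm_num)).hasFDerivAt
    have h2 : HasFDerivAt (fun y => -ρ y / ε - 1) (-ε⁻¹ • fderiv ℝ ρ x) x := by
      have := (h1.const_mul (-ε⁻¹)).sub_const 1
      refine this.congr_of_eventuallyEq (Eventually.of_forall fun y => ?_)
      simp only [div_eq_mul_inv]; ring
    exact ((Real.smoothTransition.contDiff (n := 1)).differentiable
      (by norm_num) _).hasDerivAt.comp_hasFDerivAt x h2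
  have hη_cd : ContDiffOn ℝ 1 η U := by
    refine (Real.smoothTransition.contDiff (n := 1)).comp_contDiffOn ?_
    exact (((hU.contDiffOn.of_le (by norm_num)).neg).div_const ε).sub contDiffOn_const
  set ψ : Space N → ℝ := Ω.indicator fun x => v x * η x with hψ
  have hSclosed : IsClosed (K ∩ ρ ⁻¹' Iic (-ε)) :=
    hρK.preimage_isClosed_of_isClosed Metric.isClosed_closedBall isClosed_Iic
  have hSΩ : K ∩ ρ ⁻¹' Iic (-ε) ⊆ Ω := fun x hx =>
    (hU.mem_iff x (hKU hx.1)).2 (lt_of_le_of_lt hx.2 (by linarith))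
  have hsupp : tsupport ψ ⊆ K ∩ ρ ⁻¹' Iic (-ε) := by
    refine closure_minimal (fun x hx => ?_) hSclosed
    have hxne : ψ x ≠ 0 := hx
    have hxΩ : x ∈ Ω := by
      by_contra h
      exact hxne (indicator_of_notMem h _)
    rw [hψ, indicator_of_mem hxΩ] at hxne
    refine ⟨by_contra fun h => left_ne_zero_of_mul hxne (hvK x h), ?_⟩
    by_contra h
    rw [mem_preimage, mem_Iic, not_le] at h
    refine right_ne_zero_of_mul hxne (Real.smoothTransition.zero_of_nonpos ?_)
    have : -ρ x / ε ≤ 1 := by rw [div_le_one hε0]; linarith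
    linarith
  have hψeq : ∀ x ∈ Ω, ψ =ᶠ[𝓝 x] fun y => v y * η y := fun x hx => by
    filter_upwards [hΩo.mem_nhds hx] with y hy using indicator_of_mem hy _
  have hψcd : ContDiff ℝ 1 ψ := by
    refine contDiff_of_contDiffAt_tsupport (n := 1) fun x hx => ?_
    have hxS := hsupp hx
    exact ((hv.contDiffOn.contDiffAt (hΩo.mem_nhds (hSΩ hxS))).mul
      (hη_cd.contDiffAt (hU.isOpen.mem_nhds (hKU hxS.1)))).congr_of_eventuallyEq
        (hψeq x (hSΩ hxS))
  have hψc : HasCompactSupport ψ :=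
    hKc.of_isClosed_subset (isClosed_tsupport _) (hsupp.trans inter_subset_left)
  have hψ0 := h0 ψ hψcd hψc (hsupp.trans hSΩ)
  have hGi := integrableOn_of_continuousOn_closure hΩ.isBounded hG
  have hwi := integrableOn_of_continuousOn_closure hΩ.isBounded hw
  rw [← sub_zero (greenDefect Ω G w v), ← hψ0, greenDefect, greenDefect,
    ← integral_sub (hv.integrableOn_greenDefect hΩo hGi hwi)
      ((IsC1Bounded.of_hasCompactSupport hψcd hψc).integrableOn_greenDefect hΩo hGi hwi)]
  have hψfd : ∀ x ∈ Ω ∩ K, fderiv ℝ ψ x (G x) = η x * fderiv ℝ v x (G x) -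
      v x * (deriv Real.smoothTransition (-ρ x / ε - 1) * (ε⁻¹ * fderiv ℝ ρ x (G x))) := by
    intro x hx
    rw [(hψeq x hx.1).fderiv_eq,
      ((hv.differentiableAt hΩo hx.1).hasFDerivAt.fun_mul (hη_diff x (hKU hx.2))).fderiv]
    simp
    ring
  set A := K ∩ ρ ⁻¹' Icc (-(2 * ε)) 0 with hA
  have hAm : MeasurableSet A :=
    (hρK.preimage_isClosed_of_isClosed Metric.isClosed_closedBall isClosed_Icc).measurableSet
  -- The two integrands agree off the collar `{-2ε ≤ ρ}`.
  have hoff : ∀ x ∈ Ω \ (Ω ∩ A),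
      fderiv ℝ v x (G x) + w x * v x - (fderiv ℝ ψ x (G x) + w x * ψ x) = 0 := by
    intro x hx
    have hψx : ψ x = v x * η x := (hψeq x hx.1).eq_of_nhds
    by_cases hxK : x ∈ K
    · have hxρ : ρ x < -(2 * ε) := by
        by_contra! h
        exact hx.2 ⟨hx.1, hxK, h, (hneg x hxK hx.1).le⟩
      have hgt : 1 < -ρ x / ε - 1 := by
        have : 2 < -ρ x / ε := by rw [lt_div_iff₀ hε0]; linarith
        linarith
      have hd : deriv Real.smoothTransition (-ρ x / ε - 1) = 0 := by
        have : Real.smoothTransition =ᶠ[𝓝 (-ρ x / ε - 1)] fun _ => 1 :=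
          (eventually_gt_nhds hgt).mono fun y hy => Real.smoothTransition.one_of_one_le hy.le
        rw [this.deriv_eq, deriv_const]
      have hη1 : η x = 1 := Real.smoothTransition.one_of_one_le hgt.le
      rw [hψfd x ⟨hx.1, hxK⟩, hψx, hd, hη1]
      ring
    · have hz : fderiv ℝ ψ x = 0 := by
        by_contra h
        exact hxK (hsupp (tsupport_fderiv_subset ℝ (subset_tsupport _ h))).1
      rw [hψx, hvK x hxK, hvd x hxK, hz]
      simp
  rw [setIntegral_eq_of_subset_of_forall_sdiff_eq_zero hΩo.measurableSet inter_subset_left hoff]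
  have hAfin : volume A < ⊤ := (measure_mono inter_subset_left).trans_lt hKc.measure_lt_top
  have hbound : ∀ x ∈ Ω ∩ A,
      ‖fderiv ℝ v x (G x) + w x * v x - (fderiv ℝ ψ x (G x) + w x * ψ x)‖ ≤
        (B * Cg + Cw * B) + B * M * (δ / ε) := by
    intro x hx
    have hxK : x ∈ K := hx.2.1
    have hψx : ψ x = v x * η x := (hψeq x hx.1).eq_of_nhds
    rw [hψfd x ⟨hx.1, hxK⟩, hψx]
    have e : fderiv ℝ v x (G x) + w x * v x - (η x * fderiv ℝ v x (G x) -
        v x * (deriv Real.smoothTransition (-ρ x / ε - 1) * (ε⁻¹ * fderiv ℝ ρ x (G x))) +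
        w x * (v x * η x)) = (1 - η x) * (fderiv ℝ v x (G x) + w x * v x) +
        v x * deriv Real.smoothTransition (-ρ x / ε - 1) * (fderiv ℝ ρ x (G x) / ε) := by
      ring
    rw [e]
    have hη0 : 0 ≤ η x := Real.smoothTransition.nonneg _
    have hη1 : η x ≤ 1 := Real.smoothTransition.le_one _
    have hxc : x ∈ closure Ω := subset_closure hx.1
    refine (norm_add_le _ _).trans (add_le_add ?_ ?_)
    · have h1 : ‖fderiv ℝ v x (G x) + w x * v x‖ ≤ B * Cg + Cw * B := by
        refine (norm_add_le _ _).trans (add_le_add ?_ ?_)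
        · exact (ContinuousLinearMap.le_opNorm _ _).trans
            (mul_le_mul (hB x hx.1).2 (hCg x hxc) (norm_nonneg _) hB0)
        · rw [norm_mul]
          exact mul_le_mul (hCw x hxc) (hB x hx.1).1 (norm_nonneg _) hCw0
      rw [norm_mul, Real.norm_eq_abs, abs_of_nonneg (by linarith)]
      exact (mul_le_of_le_one_left (norm_nonneg _) (by linarith)).trans h1
    · have h2 : |fderiv ℝ ρ x (G x)| ≤ δ := by
        refine hflux x ⟨hx.1, hxK⟩ (le_trans ?_ hx.2.2.1)
        have : ε ≤ ε₁ := min_le_left _ _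
        linarith
      rw [norm_mul, norm_mul, norm_div, Real.norm_eq_abs, Real.norm_eq_abs, Real.norm_eq_abs,
        Real.norm_eq_abs, abs_of_pos hε0]
      have := hM (-ρ x / ε - 1)
      have := (hB x hx.1).1
      gcongr
  refine (norm_setIntegral_le_of_norm_le_const
    ((measure_mono inter_subset_right).trans_lt hAfin) hbound).trans ?_
  have hvol : volume.real (Ω ∩ A) ≤ C * ε :=
    (measureReal_mono inter_subset_right hAfin.ne).trans
      (hC ε hε0 ((min_le_right _ _).trans (min_le_right _ _)))
  calc _ ≤ ((B * Cg + Cw * B) + B * M * (δ / ε)) * (C * ε) := by gcongr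
    _ = (B * Cg + Cw * B) * C * ε + B * M * C * δ := by field_simp
    _ ≤ (B * Cg + Cw * B) * C * δ + B * M * C * δ := by gcongr
    _ = δ * (((B * Cg + Cw * B) + B * M) * C) := by ring

/-! ### Green's identity -/

/-- Green's identity with vanishing flux through the boundary. -/
theorem greenDefect_eq_zero {N : ℕ} {Ω : Set (Space N)} (hΩ : IsBoundedC2Domain Ω)
    {G : Space N → Space N} {w : Space N → ℝ} (hG : ContinuousOn G (closure Ω))
    (hw : ContinuousOn w (closure Ω))
    (hν : ∀ x ∈ frontier Ω, ∀ ν, IsOutwardUnitNormal Ω x ν → inner ℝ (G x) ν = 0)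
    (h0 : ∀ ψ : Space N → ℝ, ContDiff ℝ 1 ψ → HasCompactSupport ψ → tsupport ψ ⊆ Ω →
      greenDefect Ω G w ψ = 0)
    {v : Space N → ℝ} (hv : IsC1Bounded Ω v) : greenDefect Ω G w v = 0 := by
  have hΩo := hΩ.isOpen
  have hGi := integrableOn_of_continuousOn_closure hΩ.isBounded hG
  have hwi := integrableOn_of_continuousOn_closure hΩ.isBounded hw
  have hloc : ∀ x ∈ closure Ω, ∃ r > 0, ∀ v, IsC1Bounded Ω v →
      (∀ y ∉ Metric.closedBall x r, v y = 0) → greenDefect Ω G w v = 0 := by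
    intro x hx
    by_cases hxΩ : x ∈ Ω
    · obtain ⟨r, hr, hrΩ⟩ := Metric.nhds_basis_closedBall.mem_iff.1 (hΩo.mem_nhds hxΩ)
      refine ⟨r, hr, fun v hv hvK => ?_⟩
      have hs : tsupport v ⊆ Metric.closedBall x r :=
        closure_minimal (fun y hy => by_contra fun h => hy (hvK y h)) Metric.isClosed_closedBall
      refine h0 v (contDiff_of_contDiffAt_tsupport (n := 1) fun y hy =>
        hv.contDiffOn.contDiffAt (hΩo.mem_nhds (hrΩ (hs hy)))) ?_ (hs.trans hrΩ)
      exact (isCompact_closedBall x r).of_isClosed_subset (isClosed_tsupport _) hs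
    · exact greenDefect_eq_zero_near_boundary hΩ hG hw hν h0 ⟨hx, by rwa [hΩo.interior_eq]⟩
  choose! r hr hloc using hloc
  obtain ⟨t, ht, hcover⟩ := hΩ.isBounded.isCompact_closure.elim_nhds_subcover
    (fun x => Metric.ball x (r x / 2)) fun x hx => Metric.ball_mem_nhds x (half_pos (hr x hx))
  -- Multiplication by `1 - β`, with `β` a bump at a point of `t`, does not change the defect. The
  -- product of these factors vanishes on `Ω`.
  have hind : ∀ s : Finset (Space N), (∀ x ∈ s, x ∈ t) → ∃ u, IsC1Bounded Ω u ∧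
      greenDefect Ω G w u = greenDefect Ω G w v ∧
      ∀ x ∈ s, ∀ y ∈ Metric.ball x (r x / 2), u y = 0 := by
    classical
    intro s
    induction s using Finset.induction_on with
    | empty => exact fun _ => ⟨v, hv, rfl, by simp⟩
    | insert a s ha ih =>
      intro hs
      obtain ⟨u, hu, hud, hu0⟩ := ih fun x hx => hs x (Finset.mem_insert_of_mem hx)
      have hat := ht a (hs a (Finset.mem_insert_self a s))
      have hra := hr a hat
      let β : ContDiffBump a := ⟨r a / 2, r a, half_pos hra, half_lt_self hra⟩
      have hβ : IsC1Bounded Ω β := IsC1Bounded.of_hasCompactSupport β.contDiff β.hasCompactSupport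
      have hβu := hβ.mul hu hΩo
      have hzero : greenDefect Ω G w (fun x => β x * u x) = 0 := by
        refine hloc a hat _ hβu fun y hy => ?_
        rw [Metric.mem_closedBall, not_le] at hy
        rw [β.zero_of_le_dist hy.le, zero_mul]
      refine ⟨fun x => u x - β x * u x, hu.sub hβu hΩo, ?_, ?_⟩
      · rw [← hud, ← sub_zero (greenDefect Ω G w u), ← hzero, greenDefect, greenDefect, greenDefect,
          ← integral_sub (hu.integrableOn_greenDefect hΩo hGi hwi)
            (hβu.integrableOn_greenDefect hΩo hGi hwi)]
        refine setIntegral_congr_fun hΩo.measurableSet fun x hx => ?_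
        rw [fderiv_fun_sub (hu.differentiableAt hΩo hx) (hβu.differentiableAt hΩo hx), sub_apply]
        ring
      · intro x hx y hy
        change u y - β y * u y = 0
        rcases Finset.mem_insert.1 hx with rfl | hx
        · rw [β.one_of_mem_closedBall (Metric.ball_subset_closedBall hy)]
          ring
        · rw [hu0 x hx y hy]
          ring
  obtain ⟨u, -, hud, hu0⟩ := hind t fun x hx => hx
  have hu : ∀ y ∈ Ω, u y = 0 := by
    intro y hy
    obtain ⟨x, hx, hyx⟩ := mem_iUnion₂.1 (hcover (subset_closure hy))
    exact hu0 x hx y hyx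
  rw [← hud, greenDefect]
  refine setIntegral_eq_zero_of_forall_eq_zero fun x hx => ?_
  have : u =ᶠ[𝓝 x] fun _ => 0 := by filter_upwards [hΩo.mem_nhds hx] with y hy using hu y hy
  rw [hu x hx, this.fderiv_eq]
  simp

/-! ### Integration of functions in `C(Ω̄)` -/

theorem zeroExt_of_mem {N : ℕ} {Ω : Set (Space N)} (v : CBar Ω) {x : Space N} (hx : x ∈ closure Ω) :
    zeroExt v x = v ⟨x, hx⟩ :=
  dif_pos hx

theorem continuousOn_zeroExt {N : ℕ} {Ω : Set (Space N)} (v : CBar Ω) :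
    ContinuousOn (zeroExt v) (closure Ω) := by
  rw [continuousOn_iff_continuous_domRestrict]
  convert v.continuous using 1
  ext x
  exact zeroExt_of_mem v x.2

theorem abs_zeroExt_le {N : ℕ} {Ω : Set (Space N)} (v : CBar Ω) (x : Space N) :
    |zeroExt v x| ≤ ‖v‖ := by
  unfold zeroExt
  split_ifs with h
  · exact v.norm_coe_le_norm ⟨x, h⟩
  · simp

theorem zeroExt_mul {N : ℕ} {Ω : Set (Space N)} (v w : CBar Ω) (x : Space N) :
    zeroExt (v * w) x = zeroExt v x * zeroExt w x := by
  unfold zeroExt; split_ifs <;> simp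

theorem zeroExt_add {N : ℕ} {Ω : Set (Space N)} (v w : CBar Ω) (x : Space N) :
    zeroExt (v + w) x = zeroExt v x + zeroExt w x := by
  unfold zeroExt; split_ifs <;> simp

theorem zeroExt_smul {N : ℕ} {Ω : Set (Space N)} (c : ℝ) (v : CBar Ω) (x : Space N) :
    zeroExt (c • v) x = c * zeroExt v x := by
  unfold zeroExt; split_ifs <;> simp

theorem integrableOn_zeroExt {N : ℕ} {Ω : Set (Space N)} (hb : Bornology.IsBounded Ω)
    (v : CBar Ω) : IntegrableOn (zeroExt v) Ω :=
  integrableOn_of_continuousOn_closure hb (continuousOn_zeroExt v)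

/-- The functional `v ↦ ∫_Ω v` on `C(Ω̄)`. -/
noncomputable def integralCLM {N : ℕ} {Ω : Set (Space N)} (hb : Bornology.IsBounded Ω) :
    CBar Ω →L[ℝ] ℝ :=
  LinearMap.mkContinuous
    { toFun := fun v => ∫ x in Ω, zeroExt v x
      map_add' := fun v w => by
        simp_rw [zeroExt_add]
        exact integral_add (integrableOn_zeroExt hb v) (integrableOn_zeroExt hb w)
      map_smul' := fun c v => by
        simp_rw [zeroExt_smul, integral_const_mul]; rfl }
    (volume.real Ω) fun v => by
      rw [mul_comm]
      exact norm_setIntegral_le_of_norm_le_const hb.measure_lt_top fun x _ => abs_zeroExt_le v x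

theorem integralCLM_apply {N : ℕ} {Ω : Set (Space N)} (hb : Bornology.IsBounded Ω) (v : CBar Ω) :
    integralCLM hb v = ∫ x in Ω, zeroExt v x := rfl

theorem hasDerivAt_zeroExt {N : ℕ} {Ω : Set (Space N)} {u : ℝ → CBar Ω} {u' : CBar Ω} {t : ℝ}
    (h : HasDerivAt u u' t) (x : Space N) :
    HasDerivAt (fun s => zeroExt (u s) x) (zeroExt u' x) t := by
  by_cases hx : x ∈ closure Ω
  · simp_rw [zeroExt_of_mem _ hx]
    exact (BoundedContinuousFunction.evalCLM ℝ (⟨x, hx⟩ : closure Ω)).hasFDerivAt.comp_hasDerivAt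
      t h
  · simp only [zeroExt, dif_neg hx]
    exact hasDerivAt_const _ _

/-! ### The Dirichlet form on the domain of the Neumann Laplacian -/

/-- The gradient of an element of the domain, extended continuously to `Ω̄`, satisfies Green's
identity against every bounded `C¹` function. -/
theorem HasNeumannLaplacian.exists_gradient {N : ℕ} {Ω : Set (Space N)} {v w : CBar Ω}
    (hΩ : IsBoundedC2Domain Ω) (h : HasNeumannLaplacian Ω v w) :
    ∃ G : Space N → Space N, ContinuousOn G (closure Ω) ∧ (∀ x ∈ Ω, gradient (zeroExt v) x = G x) ∧
      IsC1Bounded Ω (zeroExt v) ∧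
      ∀ φ, IsC1Bounded Ω φ → greenDefect Ω G (zeroExt w) φ = 0 := by
  obtain ⟨-, hlap, G, hG, hGv, hν⟩ := h
  have hΩo := hΩ.isOpen
  have hGi := integrableOn_of_continuousOn_closure hΩ.isBounded hG
  have hwi := integrableOn_zeroExt hΩ.isBounded w
  have hGo : ContinuousOn G Ω := hG.mono subset_closure
  refine ⟨G, hG, fun x hx => (hGv x hx).gradient, ⟨contDiffOn_one_of_hasGradientAt hΩo hGo hGv, ?_⟩,
    fun φ hφ => ?_⟩
  · obtain ⟨C, hC⟩ := hΩ.isBounded.isCompact_closure.exists_bound_of_continuousOn hG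
    refine ⟨max ‖v‖ C, fun x hx => ⟨(abs_zeroExt_le v x).trans (le_max_left _ _), ?_⟩⟩
    rw [(hGv x hx).hasFDerivAt.fderiv, LinearIsometryEquiv.norm_map]
    exact (hC x (subset_closure hx)).trans (le_max_right _ _)
  · refine greenDefect_eq_zero hΩ hG (continuousOn_zeroExt w) hν (fun ψ hψ hc hs => ?_) hφ
    exact greenDefect_of_compactSupport hΩo hGi hwi
      (fun χ hχ => greenDefect_testFunction hΩo hGo hwi hGv hlap hχ) hψ hc hs

theorem HasNeumannLaplacian.integrableOn_norm_gradient_sq {N : ℕ} {Ω : Set (Space N)}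
    {v w : CBar Ω} (hΩ : IsBoundedC2Domain Ω) (h : HasNeumannLaplacian Ω v w) :
    IntegrableOn (fun x => ‖gradient (zeroExt v) x‖ ^ 2) Ω := by
  obtain ⟨G, hG, hGv, -⟩ := h.exists_gradient hΩ
  refine (integrableOn_of_continuousOn_closure hΩ.isBounded (hG.norm.pow 2)).congr_fun
    (fun x hx => ?_) hΩ.isOpen.measurableSet
  rw [hGv x hx, Pi.pow_apply]

theorem HasNeumannLaplacian.integral_eq_zero {N : ℕ} {Ω : Set (Space N)} {v w : CBar Ω}
    (hΩ : IsBoundedC2Domain Ω) (h : HasNeumannLaplacian Ω v w) :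
    ∫ x in Ω, zeroExt w x = 0 := by
  obtain ⟨G, -, -, -, hgreen⟩ := h.exists_gradient hΩ
  simpa [greenDefect] using hgreen _ (IsC1Bounded.const Ω 1)

theorem HasNeumannLaplacian.integral_inner_gradient {N : ℕ} {Ω : Set (Space N)}
    {v₁ w₁ v₂ w₂ : CBar Ω} (hΩ : IsBoundedC2Domain Ω) (h₁ : HasNeumannLaplacian Ω v₁ w₁)
    (h₂ : HasNeumannLaplacian Ω v₂ w₂) :
    ∫ x in Ω, inner ℝ (gradient (zeroExt v₁) x) (gradient (zeroExt v₂) x) =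
      - integralCLM hΩ.isBounded (w₁ * v₂) := by
  obtain ⟨G₁, hG₁, hGv₁, -, hgreen⟩ := h₁.exists_gradient hΩ
  obtain ⟨G₂, hG₂, hGv₂, hc₂, -⟩ := h₂.exists_gradient hΩ
  have h := hgreen _ hc₂
  have hi : ∀ x ∈ Ω, fderiv ℝ (zeroExt v₂) x (G₁ x) + zeroExt w₁ x * zeroExt v₂ x =
      inner ℝ (G₁ x) (G₂ x) + zeroExt (w₁ * v₂) x := fun x hx => by
    rw [zeroExt_mul, ← hGv₂ x hx, real_inner_comm]
    simp [gradient]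
  rw [greenDefect, setIntegral_congr_fun hΩ.isOpen.measurableSet hi,
    integral_add (integrableOn_of_continuousOn_closure hΩ.isBounded (hG₁.inner hG₂))
      (integrableOn_zeroExt hΩ.isBounded _)] at h
  rw [integralCLM_apply, ← eq_neg_of_add_eq_zero_left h]
  refine setIntegral_congr_fun hΩ.isOpen.measurableSet fun x hx => ?_
  simp only [hGv₁ x hx, hGv₂ x hx]

/-- The polarised increment of the Dirichlet energy: it involves the increment of `v` only, so that
the energy is differentiable along a curve whose velocity need not lie in the domain. -/
theorem HasNeumannLaplacian.integral_norm_gradient_sq_eq {N : ℕ} {Ω : Set (Space N)}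
    {v₁ w₁ v₂ w₂ : CBar Ω} (hΩ : IsBoundedC2Domain Ω) (h₁ : HasNeumannLaplacian Ω v₁ w₁)
    (h₂ : HasNeumannLaplacian Ω v₂ w₂) :
    ∫ x in Ω, ‖gradient (zeroExt v₂) x‖ ^ 2 = (∫ x in Ω, ‖gradient (zeroExt v₁) x‖ ^ 2) -
      integralCLM hΩ.isBounded ((w₂ + w₁) * (v₂ - v₁)) := by
  have h11 := h₁.integral_inner_gradient hΩ h₁
  have h22 := h₂.integral_inner_gradient hΩ h₂
  have h12 := h₁.integral_inner_gradient hΩ h₂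
  have h21 := h₂.integral_inner_gradient hΩ h₁
  have hsymm := h12.symm.trans
    ((integral_congr_ae (ae_of_all _ fun x => real_inner_comm _ _)).trans h21)
  simp_rw [real_inner_self_eq_norm_sq] at h11 h22
  rw [h11, h22, show (w₂ + w₁) * (v₂ - v₁) = w₂ * v₂ - w₂ * v₁ + (w₁ * v₂ - w₁ * v₁) by ring,
    map_add, map_sub, map_sub]
  linarith

/-! ### Differentiation of the energy along a solution -/

/-- At the zero `t` of the second factor, a product is differentiable as soon as the first factor is
continuous. -/
theorem hasDerivAt_mul_sub_of_continuousAt {A : Type*} [NormedRing A] [NormedAlgebra ℝ A]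
    {a b : ℝ → A} {b' : A} {t : ℝ} (ha : ContinuousAt a t) (hb : HasDerivAt b b' t) :
    HasDerivAt (fun s => a s * (b s - b t)) (a t * b') t := by
  rw [hasDerivAt_iff_tendsto_slope] at hb ⊢
  refine ((ha.tendsto.mono_left nhdsWithin_le_nhds).mul hb).congr fun s => ?_
  simp [slope_def_module]

theorem hasDerivAt_mul_abs_rpow {p : ℝ} (hp : 1 < p) (y : ℝ) :
    HasDerivAt (fun y : ℝ => y * |y| ^ p) ((p + 1) * |y| ^ p) y := by
  refine ((hasDerivAt_id y).mul (hasDerivAt_abs_rpow y hp)).congr_deriv ?_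
  rcases eq_or_ne y 0 with rfl | hy
  -- At `y = 0` both sides vanish, whatever the value of `0 ^ (p - 2)`.
  · have : (0 : ℝ) ^ p = 0 := Real.zero_rpow (by linarith)
    simp [this]
  · have h : |y| ^ p = |y| ^ (p - 2) * y ^ 2 := by
      rw [← sq_abs, ← Real.rpow_natCast |y| 2, ← Real.rpow_add (abs_pos.2 hy)]
      norm_num
    rw [h]
    simp only [id]
    ring

theorem integrableOn_mul_abs_rpow {N : ℕ} {Ω : Set (Space N)} (hb : Bornology.IsBounded Ω)
    (v : CBar Ω) {p : ℝ} (hp : 0 ≤ p) :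
    IntegrableOn (fun x => zeroExt v x * |zeroExt v x| ^ p) Ω :=
  integrableOn_of_continuousOn_closure hb ((continuousOn_zeroExt v).mul
    ((continuousOn_zeroExt v).abs.rpow_const fun _ _ => Or.inr hp))

theorem hasDerivAt_integral_mul_abs_rpow {N : ℕ} {Ω : Set (Space N)} (hb : Bornology.IsBounded Ω)
    {p : ℝ} (hp : 1 < p) {u u' : ℝ → CBar Ω} {t : ℝ}
    (hu : ∀ᶠ s in 𝓝 t, HasDerivAt u (u' s) s) (hu' : ContinuousAt u' t) :
    HasDerivAt (fun s => ∫ x in Ω, zeroExt (u s) x * |zeroExt (u s) x| ^ p)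
      (∫ x in Ω, (p + 1) * |zeroExt (u t) x| ^ p * zeroExt (u' t) x) t := by
  have hp0 : 0 ≤ p := by linarith
  have h1 : ∀ᶠ s in 𝓝 t, ‖u s‖ < ‖u t‖ + 1 :=
    hu.self_of_nhds.continuousAt.norm.eventually_lt continuousAt_const (by simp)
  have h2 : ∀ᶠ s in 𝓝 t, ‖u' s‖ < ‖u' t‖ + 1 :=
    hu'.norm.eventually_lt continuousAt_const (by simp)
  refine (hasDerivAt_integral_of_dominated_loc_of_deriv_le (μ := volume.restrict Ω)
    (F := fun s x => zeroExt (u s) x * |zeroExt (u s) x| ^ p)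
    (F' := fun s x => (p + 1) * |zeroExt (u s) x| ^ p * zeroExt (u' s) x)
    (bound := fun _ => (p + 1) * (‖u t‖ + 1) ^ p * (‖u' t‖ + 1))
    (hu.and (h1.and h2)) ?_ ?_ ?_ ?_ ?_ ?_).2
  · exact Eventually.of_forall fun s =>
      (integrableOn_mul_abs_rpow hb (u s) hp0).aestronglyMeasurable
  · exact integrableOn_mul_abs_rpow hb (u t) hp0
  · exact (integrableOn_of_continuousOn_closure hb ((continuousOn_const.mul
      ((continuousOn_zeroExt (u t)).abs.rpow_const fun _ _ => Or.inr hp0)).mul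
        (continuousOn_zeroExt (u' t)))).aestronglyMeasurable
  · refine ae_of_all _ fun x s hs => ?_
    have h3 := (abs_zeroExt_le (u s) x).trans hs.2.1.le
    have h4 := (abs_zeroExt_le (u' s) x).trans hs.2.2.le
    rw [norm_mul, norm_mul, Real.norm_of_nonneg (by linarith : 0 ≤ p + 1),
      Real.norm_of_nonneg (by positivity : 0 ≤ |zeroExt (u s) x| ^ p), Real.norm_eq_abs]
    gcongr
  · exact integrableOn_const hb.measure_lt_top.ne
  · exact ae_of_all _ fun x s hs =>
      (hasDerivAt_mul_abs_rpow hp _).comp s (hasDerivAt_zeroExt hs.1 x)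

theorem energy_eq {N : ℕ} {Ω : Set (Space N)} (hΩ : IsBoundedC2Domain Ω) {v w : CBar Ω}
    (h : HasNeumannLaplacian Ω v w) {p : ℝ} (hp : 0 ≤ p) :
    energy Ω p v = 1 / 2 * (∫ x in Ω, ‖gradient (zeroExt v) x‖ ^ 2) -
      1 / (p + 1) * ∫ x in Ω, zeroExt v x * |zeroExt v x| ^ p := by
  rw [energy, integral_sub ((h.integrableOn_norm_gradient_sq hΩ).const_mul _)
    ((integrableOn_mul_abs_rpow hΩ.isBounded v hp).const_mul _), integral_const_mul,
    integral_const_mul]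

/-- The energy identity `d/dt E(u(t)) = - ∫_Ω u_t²`. -/
theorem hasDerivAt_energy {N : ℕ} {Ω : Set (Space N)} (hΩ : IsBoundedC2Domain Ω) {p : ℝ}
    (hp : 1 < p) {u u' w : ℝ → CBar Ω} {t : ℝ} (hu : ∀ᶠ s in 𝓝 t, HasDerivAt u (u' s) s)
    (hu' : ContinuousAt u' t) (hw : ContinuousAt w t)
    (hlap : ∀ᶠ s in 𝓝 t, HasNeumannLaplacian Ω (u s) (w s))
    (heq : ∀ x ∈ Ω, zeroExt (u' t) x - zeroExt (w t) x
        = |zeroExt (u t) x| ^ p - ⨍ y in Ω, |zeroExt (u t) y| ^ p) :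
    HasDerivAt (fun s => energy Ω p (u s)) (-∫ x in Ω, zeroExt (u' t) x ^ 2) t := by
  have hb := hΩ.isBounded
  have hm := hΩ.isOpen.measurableSet
  have hp0 : 0 ≤ p := by linarith
  have hlt := hlap.self_of_nhds
  have hD : HasDerivAt (fun s => ∫ x in Ω, ‖gradient (zeroExt (u s)) x‖ ^ 2)
      (-integralCLM hb ((w t + w t) * u' t)) t := by
    have h1 := hasDerivAt_mul_sub_of_continuousAt (hw.add (continuousAt_const (y := w t)))
      hu.self_of_nhds
    have h2 := ((integralCLM hb).hasFDerivAt.comp_hasDerivAt t h1).const_sub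
      (∫ x in Ω, ‖gradient (zeroExt (u t)) x‖ ^ 2)
    exact h2.congr_of_eventuallyEq
      (hlap.mono fun s hs => hlt.integral_norm_gradient_sq_eq hΩ hs)
  have hP := hasDerivAt_integral_mul_abs_rpow hb hp hu hu'
  have hE := ((hD.const_mul (1 / 2)).sub (hP.const_mul (1 / (p + 1)))).congr_of_eventuallyEq
    (hlap.mono fun s hs => energy_eq hΩ hs hp0)
  refine hE.congr_deriv ?_
  set m := ⨍ y in Ω, |zeroExt (u t) y| ^ p with hmdef
  have hiu' := integrableOn_zeroExt hb (u' t)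
  have hiw := integrableOn_zeroExt hb (w t)
  have hcp : ContinuousOn (fun x => |zeroExt (u t) x| ^ p) (closure Ω) :=
    (continuousOn_zeroExt (u t)).abs.rpow_const fun _ _ => Or.inr hp0
  have hip := integrableOn_of_continuousOn_closure hb hcp
  have him : IntegrableOn (fun _ => m) Ω := integrableOn_const hb.measure_lt_top.ne
  have hpm : IntegrableOn (fun x => |zeroExt (u t) x| ^ p - m) Ω := hip.sub him
  have hpos : volume.real Ω ≠ 0 :=
    (ENNReal.toReal_pos (hΩ.isOpen.measure_pos volume hΩ.isConnected.nonempty).ne'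
      hb.measure_lt_top.ne).ne'
  -- The equation preserves the mean: both `Δu` and the right-hand side have mean zero.
  have hmean : ∫ x in Ω, zeroExt (u' t) x = 0 := by
    have e : ∀ x ∈ Ω, zeroExt (u' t) x = zeroExt (w t) x + (|zeroExt (u t) x| ^ p - m) :=
      fun x hx => by linarith [heq x hx]
    rw [setIntegral_congr_fun hm e, integral_add hiw hpm, integral_sub hip him,
      hlt.integral_eq_zero hΩ, setIntegral_const, hmdef, setAverage_eq, smul_smul,
      mul_inv_cancel₀ hpos]
    simp
  have hw' : integralCLM hb ((w t + w t) * u' t) =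
      ∫ x in Ω, (2 * zeroExt (u' t) x ^ 2 + 2 * m * zeroExt (u' t) x -
        2 * (|zeroExt (u t) x| ^ p * zeroExt (u' t) x)) := by
    rw [integralCLM_apply]
    refine setIntegral_congr_fun hm fun x hx => ?_
    have e : zeroExt (w t) x = zeroExt (u' t) x - |zeroExt (u t) x| ^ p + m := by
      linarith [heq x hx]
    simp only [zeroExt_mul, zeroExt_add, e]
    ring
  have hsq : IntegrableOn (fun x => zeroExt (u' t) x ^ 2) Ω :=
    integrableOn_of_continuousOn_closure hb ((continuousOn_zeroExt (u' t)).pow 2)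
  have hpu : IntegrableOn (fun x => |zeroExt (u t) x| ^ p * zeroExt (u' t) x) Ω :=
    integrableOn_of_continuousOn_closure hb (hcp.mul (continuousOn_zeroExt (u' t)))
  have hsum : IntegrableOn (fun x => 2 * zeroExt (u' t) x ^ 2 + 2 * m * zeroExt (u' t) x) Ω :=
    (hsq.const_mul 2).add (hiu'.const_mul (2 * m))
  rw [hw', integral_sub hsum (hpu.const_mul 2),
    integral_add (hsq.const_mul 2) (hiu'.const_mul (2 * m)), integral_const_mul,
    integral_const_mul, integral_const_mul, hmean]
  simp_rw [mul_assoc]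
  rw [integral_const_mul]
  have : p + 1 ≠ 0 := by linarith
  field_simp
  ring

end NonlocalHeat

theorem proposition3p1 (N : ℕ) (hN : 0 < N) (Ω : Set (NonlocalHeat.Space N))
    (hΩ : NonlocalHeat.IsBoundedC2Domain Ω) (p : ℝ) (hp : 1 < p) (T : EReal)
    (u₀ : NonlocalHeat.CBar Ω) (u : ℝ → NonlocalHeat.CBar Ω)
    (hu : NonlocalHeat.IsSolution Ω p T u₀ u) :
    (∀ t : ℝ, 0 < t → (t : EReal) < T →
      IntegrableOn (fun x => ‖gradient (NonlocalHeat.zeroExt (u t)) x‖ ^ 2) Ω ∧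
      IntegrableOn
        (fun x => NonlocalHeat.zeroExt (u t) x * |NonlocalHeat.zeroExt (u t) x| ^ p) Ω) ∧
    AntitoneOn (fun t : ℝ => NonlocalHeat.energy Ω p (u t))
      {t : ℝ | 0 < t ∧ (t : EReal) < T} := by
  obtain ⟨-, -, -, -, u', w, hu', hw, h⟩ := hu
  refine ⟨fun t ht htT => ⟨(h t ht htT).2.1.integrableOn_norm_gradient_sq hΩ,
    NonlocalHeat.integrableOn_mul_abs_rpow hΩ.isBounded (u t) (by linarith)⟩, ?_⟩
  set S : Set ℝ := {t : ℝ | 0 < t ∧ (t : EReal) < T} with hS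
  have hSo : IsOpen S :=
    isOpen_Ioi.inter (isOpen_Iio.preimage continuous_coe_real_ereal)
  have hSc : Convex ℝ S := by
    refine OrdConnected.convex ⟨fun a ha b hb c hc => ⟨ha.1.trans_le hc.1, ?_⟩⟩
    exact (EReal.coe_le_coe_iff.2 hc.2).trans_lt hb.2
  have hE : ∀ t ∈ S, HasDerivAt (fun s => NonlocalHeat.energy Ω p (u s))
      (-∫ x in Ω, NonlocalHeat.zeroExt (u' t) x ^ 2) t := fun t ht =>
    have hSt : ∀ᶠ s in 𝓝 t, s ∈ S := hSo.mem_nhds ht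
    NonlocalHeat.hasDerivAt_energy hΩ hp (hSt.mono fun s hs => (h s hs.1 hs.2).1)
      (hu'.continuousAt hSt) (hw.continuousAt hSt) (hSt.mono fun s hs => (h s hs.1 hs.2).2.1)
      (h t ht.1 ht.2).2.2
  refine antitoneOn_of_deriv_nonpos hSc (fun t ht => (hE t ht).continuousAt.continuousWithinAt)
    (fun t ht => ?_) fun t ht => ?_
  · exact (hE t (interior_subset ht)).differentiableAt.differentiableWithinAt
  · rw [(hE t (interior_subset ht)).deriv, neg_nonpos]
    exact integral_nonneg fun x => sq_nonneg _
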